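/- For a bounded metric space $X$ let $\mathcal P_X$ be the set of Radon probability measures on $X$ (Borel probability measures that are inner regular with respect to compact sets) with the weak topology, and let $\mathcal P^{\mathrm{fin}}_X\subseteq\mathcal P_X$ be the subspace of finitely supported ones. For $\alpha,\beta\in\mathcal P_X$ put $d_{W,\infty}^X(\alpha,\beta)=\inf_\mu\sup_{(x,x')\in\operatorname{supp}\mu}d_X(x,x')$, the infimum being over all couplings $\mu$ of $\alpha$ and $\beta$. For arbitrary maps $f\colon X\to Y$, $g\colon Y\to X$ of metric spaces put $\operatorname{dis}(f)=\sup_{x,x'}|d_X(x,x')-d_Y(f(x),f(x'))|$, $\operatorname{codis}(f,g)=\sup_{x,y}|d_X(x,g(y))-d_Y(f(x),y)|$ and $$d_{\mathrm{GH}}(X,Y)=\tfrac12\inf_{f,g}\max\big(\operatorname{dis}(f),\operatorname{dis}(g),\operatorname{codis}(f,g)\big)\in[0,\infty].$$ Let $L>0$. An *$L$-controlled invariant* $\mathfrak i$ assigns to every bounded metric space $X$ a function $\mathfrak i^X\colon\mathcal P_X\to\mathbb R$ such that 1. for all bounded metric spaces $X,Y$, every Borel map $f\colon X\to Y$ with finite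 image and every $\alpha\in\mathcal P_X$, $\ \mathfrak i^Y(f_\sharp\alpha)\le\mathfrak i^X(\alpha)+L\operatorname{dis}(f)$; 2. for every bounded metric space $X$ and all $\alpha,\beta\in\mathcal P_X$, $\ |\mathfrak i^X(\alpha)-\mathfrak i^X(\beta)|\le 2L\,d_{W,\infty}^X(\alpha,\beta)$. An $L$-controlled invariant of finitely supported measures is defined in the same way with $\mathcal P^{\mathrm{fin}}$ in place of $\mathcal P$. For topological spaces $A,B$ with arbitrary functions $\varphi\colon A\to\mathbb R$, $\psi\colon B\to\mathbb R$ and $\delta\ge0$, a *$\delta$-map* $(A,\varphi)\to(B,\psi)$ is a continuous $\Phi\colon A\to B$ with $\psi\circ\Phi\le\varphi+\delta$; a *$\delta$-homotopy* is a homotopy all of whose stages are $\delta$-maps. The pairs are *$\delta$-homotopy equivalent* if there are $\delta$-maps $\Phi\colon A\to B$ and $\Psi\colon B\to A$ such that $\Psi\circ\Phi$ is $2\delta$-homotopic to $\mathrm{id}_A$ with respect to $(\varphi,\varphi)$ and $\Phi\circ\Psi$ is $2\delta$-homotopic to $\mathrm{id}_B$ with respect to $(\psi,\psi)$. Let $d_{\mathrm{HT}}((A,\varphi),(B,\psi))\in[0,\infty]$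 be the infimum of all such $\delta$. Let $[A,\varphi]_\bullet$ be the sublevel set filtration $r\mapsto\varphi^{-1}((-\infty,r))$, $r\in\mathbb R$, let $H_k$ be singular homology with coefficients in a fixed field, and let $d_{\mathrm I}$ be the interleaving distance of persistence modules $(\mathbb R,\le)\to\mathrm{Vec}$. **Theorem.** Let $\mathfrak i$ be an $L$-controlled invariant. Then for any two totally bounded metric spaces $X,Y$ and every integer $k\ge0$, $$d_{\mathrm I}\big(H_k\circ[\mathcal P_X,\mathfrak i^X]_\bullet,\,H_k\circ[\mathcal P_Y,\mathfrak i^Y]_\bullet\big)\le d_{\mathrm{HT}}\big((\mathcal P_X,\mathfrak i^X),(\mathcal P_Y,\mathfrak i^Y)\big)\le 2L\,d_{\mathrm{GH}}(X,Y),$$ $$d_{\mathrm I}\big(H_k\circ[\mathcal P^{\mathrm{fin}}_X,\mathfrak i^X]_\bullet,\,H_k\circ[\mathcal P^{\mathrm{fin}}_Y,\mathfrak i^Y]_\bullet\big)\le d_{\mathrm{HT}}\big((\mathcal P^{\mathrm{fin}}_X,\mathfrak i^X),(\mathcal P^{\mathrm{fin}}_Y,\mathfrak i^Y)\big)\le 2L\,d_{\mathrm{GH}}(X,Y).$$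 The second line also holds when $\mathfrak i$ is only an $L$-controlled invariant of finitely supported measures. -/

import Mathlib

open MeasureTheory CategoryTheory
open scoped ENNReal NNReal unitInterval

universe u v

namespace PersistentThickening

/-! ### Totally bounded metric spaces -/

/-- A metric space all of which is totally bounded. -/
class TotallyBoundedSpace (X : Type u) [MetricSpace X] : Prop where
  totallyBounded_univ : TotallyBounded (Set.univ : Set X)

instance (X : Type u) [MetricSpace X] [TotallyBoundedSpace X] : BoundedSpace X :=
  ⟨(TotallyBoundedSpace.totallyBounded_univ (X := X)).isBounded⟩

/-! ### Distortion, codistortion, Gromov–Hausdorff distance -/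

/-- Distortion of an arbitrary map: `sup_{x, x'} |d(x, x') - d(f x, f x')|`, valued in `[0, ∞]`. -/
noncomputable def distortion {X Y : Type u} [MetricSpace X] [MetricSpace Y] (f : X → Y) : ℝ≥0∞ :=
  ⨆ (x : X) (x' : X), ENNReal.ofReal |dist x x' - dist (f x) (f x')|

/-- Codistortion of a pair of arbitrary maps: `sup_{x, y} |d(x, g y) - d(f x, y)|`. -/
noncomputable def codistortion {X Y : Type u} [MetricSpace X] [MetricSpace Y]
    (f : X → Y) (g : Y → X) : ℝ≥0∞ :=
  ⨆ (x : X) (y : Y), ENNReal.ofReal |dist x (g y) - dist (f x) y|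

/-- Gromov–Hausdorff distance, valued in `[0, ∞]` (it is `∞` when exactly one space is empty). -/
noncomputable def ghDistance (X Y : Type u) [MetricSpace X] [MetricSpace Y] : ℝ≥0∞ :=
  (1 / 2) * ⨅ (f : X → Y) (g : Y → X), max (max (distortion f) (distortion g)) (codistortion f g)

/-- The distortion of a map between bounded metric spaces is finite. -/
theorem distortion_ne_top {X Y : Type u} [MetricSpace X] [MetricSpace Y] [BoundedSpace X]
    [BoundedSpace Y] (f : X → Y) : distortion f ≠ ⊤ := by
  obtain ⟨C, hC⟩ := Metric.boundedSpace_iff.1 (inferInstance : BoundedSpace X)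
  obtain ⟨D, hD⟩ := Metric.boundedSpace_iff.1 (inferInstance : BoundedSpace Y)
  refine ne_top_of_le_ne_top (b := ENNReal.ofReal (C + D)) ENNReal.ofReal_ne_top ?_
  refine iSup_le fun x => iSup_le fun x' => ENNReal.ofReal_le_ofReal ?_
  have h1 := hC x x'
  have h2 := hD (f x) (f x')
  have h3 : 0 ≤ dist x x' := dist_nonneg
  have h4 : 0 ≤ dist (f x) (f x') := dist_nonneg
  rw [abs_le]
  constructor <;> linarith

/-! ### Spaces of Radon probability measures -/

/-- Radon probability measures on `X`: Borel probability measures `α` such that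
`α B = sup {α K | K ⊆ B compact}` for every Borel set `B`.
The topology is the weak topology, as a subspace of `ProbabilityMeasure X`. -/
abbrev RadonProb (X : Type u) [MetricSpace X] [MeasurableSpace X] [BorelSpace X] : Type u :=
  {α : ProbabilityMeasure X // (α : Measure X).InnerRegular}

/-- Finitely supported Radon probability measures, with the subspace topology. -/
abbrev FinProb (X : Type u) [MetricSpace X] [MeasurableSpace X] [BorelSpace X] : Type u :=
  {α : RadonProb X // (α.1 : Measure X).support.Finite}

theorem innerRegular_map_of_finite_range {X Y : Type u} [MetricSpace X] [MeasurableSpace X]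
    [MetricSpace Y] [MeasurableSpace Y] [BorelSpace Y]
    (μ : Measure X) {f : X → Y} (hf : Measurable f) (hfin : (Set.range f).Finite) :
    (μ.map f).InnerRegular := by
  refine ⟨fun B hB r hr => ⟨B ∩ Set.range f, Set.inter_subset_left,
    (hfin.subset Set.inter_subset_right).isCompact, ?_⟩⟩
  rw [Measure.map_apply hf hB] at hr
  rw [Measure.map_apply hf (hB.inter hfin.measurableSet)]
  simpa using hr

theorem support_map_subset_range {X Y : Type u} [MetricSpace X] [MeasurableSpace X]
    [MetricSpace Y] [MeasurableSpace Y] [BorelSpace Y]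
    (μ : Measure X) {f : X → Y} (hf : Measurable f) (hfin : (Set.range f).Finite) :
    (μ.map f).support ⊆ Set.range f := by
  refine Measure.support_subset_of_isClosed hfin.isClosed ?_
  rw [mem_ae_iff, Measure.map_apply hf hfin.measurableSet.compl]
  simp

/-- Pushforward of a Radon probability measure under a Borel map with finitely many values
(such a pushforward is automatically Radon). -/
noncomputable def RadonProb.push {X Y : Type u} [MetricSpace X] [MeasurableSpace X] [BorelSpace X]
    [MetricSpace Y] [MeasurableSpace Y] [BorelSpace Y]
    (f : X → Y) (hf : Measurable f) (hfin : (Set.range f).Finite) (α : RadonProb X) :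
    RadonProb Y :=
  ⟨α.1.map hf.aemeasurable, innerRegular_map_of_finite_range _ hf hfin⟩

/-- Pushforward of a finitely supported probability measure under a Borel map with finitely many
values. -/
noncomputable def FinProb.push {X Y : Type u} [MetricSpace X] [MeasurableSpace X] [BorelSpace X]
    [MetricSpace Y] [MeasurableSpace Y] [BorelSpace Y]
    (f : X → Y) (hf : Measurable f) (hfin : (Set.range f).Finite) (α : FinProb X) :
    FinProb Y :=
  ⟨RadonProb.push f hf hfin α.1, hfin.subset (support_map_subset_range _ hf hfin)⟩

/-! ### The `∞`-Wasserstein distance -/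

/-- `μ` is a coupling of `α` and `β` (it is then automatically a probability measure). -/
def IsCoupling {X : Type u} [MeasurableSpace X] (μ : Measure (X × X))
    (α β : ProbabilityMeasure X) : Prop :=
  μ.map Prod.fst = (α : Measure X) ∧ μ.map Prod.snd = (β : Measure X)

/-- `inf` over couplings `μ` of `sup_{(x, x') ∈ supp μ} d(x, x')`. -/
noncomputable def wassersteinInfty {X : Type u} [MetricSpace X] [MeasurableSpace X] [BorelSpace X]
    (α β : RadonProb X) : ℝ≥0∞ :=
  ⨅ (μ : Measure (X × X)) (_ : IsCoupling μ α.1 β.1), ⨆ p ∈ μ.support, edist p.1 p.2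

/-- On a bounded metric space the `∞`-Wasserstein distance is finite. -/
theorem wassersteinInfty_ne_top {X : Type u} [MetricSpace X] [MeasurableSpace X] [BorelSpace X]
    [BoundedSpace X] (α β : RadonProb X) : wassersteinInfty α β ≠ ⊤ := by
  obtain ⟨C, hC⟩ := Metric.boundedSpace_iff.1 (inferInstance : BoundedSpace X)
  refine ne_top_of_le_ne_top (b := ENNReal.ofReal C) ENNReal.ofReal_ne_top ?_
  refine iInf₂_le_of_le ((α.1 : Measure X).prod (β.1 : Measure X)) ⟨?_, ?_⟩ ?_
  · simp
  · simp
  · refine iSup₂_le fun p _ => ?_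
    rw [edist_dist]
    exact ENNReal.ofReal_le_ofReal (hC _ _)

/-! ### Controlled invariants -/

/-- An invariant: a function `𝔦^X : 𝒫_X → ℝ` for every bounded metric space `X`. -/
abbrev Invariant : Type (u + 1) :=
  ∀ (X : Type u) [MetricSpace X] [BoundedSpace X] [MeasurableSpace X] [BorelSpace X],
    RadonProb X → ℝ

/-- An invariant defined on finitely supported measures only. -/
abbrev FinInvariant : Type (u + 1) :=
  ∀ (X : Type u) [MetricSpace X] [BoundedSpace X] [MeasurableSpace X] [BorelSpace X],
    FinProb X → ℝ

/-- `L`-controlled invariants. The distortion and the `∞`-Wasserstein distance below are finite,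
so `ENNReal.toReal` is harmless. -/
structure IsControlled (L : ℝ) (i : Invariant.{u}) : Prop where
  pos : 0 < L
  push_le : ∀ (X Y : Type u) [MetricSpace X] [BoundedSpace X] [MeasurableSpace X] [BorelSpace X]
    [MetricSpace Y] [BoundedSpace Y] [MeasurableSpace Y] [BorelSpace Y]
    (f : X → Y) (hf : Measurable f) (hfin : (Set.range f).Finite) (α : RadonProb X),
    i Y (α.push f hf hfin) ≤ i X α + L * (distortion f).toReal
  lipschitz : ∀ (X : Type u) [MetricSpace X] [BoundedSpace X] [MeasurableSpace X] [BorelSpace X]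
    (α β : RadonProb X), |i X α - i X β| ≤ 2 * L * (wassersteinInfty α β).toReal

/-- `L`-controlled invariants of finitely supported measures. -/
structure IsFinControlled (L : ℝ) (i : FinInvariant.{u}) : Prop where
  pos : 0 < L
  push_le : ∀ (X Y : Type u) [MetricSpace X] [BoundedSpace X] [MeasurableSpace X] [BorelSpace X]
    [MetricSpace Y] [BoundedSpace Y] [MeasurableSpace Y] [BorelSpace Y]
    (f : X → Y) (hf : Measurable f) (hfin : (Set.range f).Finite) (α : FinProb X),
    i Y (α.push f hf hfin) ≤ i X α + L * (distortion f).toReal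
  lipschitz : ∀ (X : Type u) [MetricSpace X] [BoundedSpace X] [MeasurableSpace X] [BorelSpace X]
    (α β : FinProb X), |i X α - i X β| ≤ 2 * L * (wassersteinInfty α.1 β.1).toReal

/-- Restriction of an invariant to finitely supported measures. -/
def Invariant.restrict (i : Invariant.{u}) : FinInvariant.{u} := fun X _ _ _ _ α => i X α.1

/-! ### The homotopy type distance -/

section HomotopyType

variable {A B : Type u} [TopologicalSpace A] [TopologicalSpace B]

/-- `Φ` is a `δ`-map from `(A, φ)` to `(B, ψ)`. -/
def IsDeltaMap (φ : A → ℝ) (ψ : B → ℝ) (δ : ℝ) (Φ : C(A, B)) : Prop :=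
  ∀ a, ψ (Φ a) ≤ φ a + δ

/-- `Φ₀` and `Φ₁` are `δ`-homotopic with respect to `(φ, ψ)`: there is a homotopy between them
all of whose stages are `δ`-maps. -/
def DeltaHomotopic (φ : A → ℝ) (ψ : B → ℝ) (δ : ℝ) (Φ₀ Φ₁ : C(A, B)) : Prop :=
  ∃ H : ContinuousMap.Homotopy Φ₀ Φ₁, ∀ t : I, IsDeltaMap φ ψ δ (H.curry t)

/-- `(A, φ)` and `(B, ψ)` are `δ`-homotopy equivalent. -/
def DeltaHomotopyEquivalent (φ : A → ℝ) (ψ : B → ℝ) (δ : ℝ) : Prop :=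
  ∃ (Φ : C(A, B)) (Ψ : C(B, A)), IsDeltaMap φ ψ δ Φ ∧ IsDeltaMap ψ φ δ Ψ ∧
    DeltaHomotopic φ φ (2 * δ) (Ψ.comp Φ) (ContinuousMap.id A) ∧
    DeltaHomotopic ψ ψ (2 * δ) (Φ.comp Ψ) (ContinuousMap.id B)

/-- The homotopy type distance, valued in `[0, ∞]`; the infimum of the empty set is `∞`. -/
noncomputable def dHT (φ : A → ℝ) (ψ : B → ℝ) : ℝ≥0∞ :=
  ⨅ (δ : ℝ≥0) (_ : DeltaHomotopyEquivalent φ ψ δ), (δ : ℝ≥0∞)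

end HomotopyType

/-! ### Sublevel set filtrations, persistent homology, interleaving distance -/

/-- The sublevel set filtration `r ↦ φ⁻¹((-∞, r))`, with the inclusions as structure maps. -/
def sublevelFiltration {A : Type u} [TopologicalSpace A] (φ : A → ℝ) : ℝ ⥤ TopCat.{u} where
  obj r := TopCat.of {a : A // φ a < r}
  map {r s} h := TopCat.ofHom
    { toFun := fun a => ⟨a.1, lt_of_lt_of_le a.2 (leOfHom h)⟩
      continuous_toFun := by fun_prop }
  map_id _ := rfl
  map_comp _ _ := rfl

/-- Singular homology `H_k` with coefficients in the field `F`, as a functor from topological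
spaces to `F`-vector spaces. The coefficient object is `F` itself, lifted to the right universe. -/
noncomputable def homologyFunctor (F : Type v) [Field F] (k : ℕ) :
    TopCat.{u} ⥤ ModuleCat.{max u v} F :=
  (AlgebraicTopology.singularHomologyFunctor (ModuleCat.{max u v} F) k).obj
    (ModuleCat.of F (ULift.{u} F))

/-- The persistent homology module `H_k ∘ (sublevel set filtration of φ)`. -/
noncomputable def persistentHomology (F : Type v) [Field F] (k : ℕ) {A : Type u}
    [TopologicalSpace A] (φ : A → ℝ) : ℝ ⥤ ModuleCat.{max u v} F :=
  sublevelFiltration φ ⋙ homologyFunctor.{u, v} F k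

/-- The translation `t ↦ t + δ` of the poset `ℝ`. -/
def shift (δ : ℝ) : ℝ ⥤ ℝ where
  obj t := t + δ
  map h := homOfLE (add_le_add_left (leOfHom h) δ)

/-- Two functors `V W : ℝ ⥤ C` are `δ`-interleaved: there are natural transformations to the
`δ`-shifts, in both directions, whose composites are the structure maps over length `2δ`. -/
def Interleaved {C : Type*} [Category C] (V W : ℝ ⥤ C) (δ : ℝ≥0) : Prop :=
  ∃ (f : V ⟶ shift δ ⋙ W) (g : W ⟶ shift δ ⋙ V),
    (∀ t : ℝ, f.app t ≫ g.app (t + δ) =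
      V.map (homOfLE (show t ≤ t + δ + δ by linarith [δ.coe_nonneg]))) ∧
    (∀ t : ℝ, g.app t ≫ f.app (t + δ) =
      W.map (homOfLE (show t ≤ t + δ + δ by linarith [δ.coe_nonneg])))

/-- The interleaving distance, valued in `[0, ∞]`. -/
noncomputable def interleavingDist {C : Type*} [Category C] (V W : ℝ ⥤ C) : ℝ≥0∞ :=
  ⨅ (δ : ℝ≥0) (_ : Interleaved V W δ), (δ : ℝ≥0∞)

end PersistentThickening

open PersistentThickening

/-! The left inequality is functoriality: a `δ`-map carries the sublevel set at `r` into the one at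
`r + δ`, and a `2δ`-homotopy to the identity restricts to sublevel sets, so homotopy invariance of
homology turns a `δ`-homotopy equivalence into a `δ`-interleaving.

For the right inequality, let `f`, `g` have distortions and codistortion at most `D`. They need not
be continuous, nor even Borel, so pushing forward along `f` is no candidate for a map of measure
spaces. Instead, a partition of unity subordinate to finitely many `ε`-balls splits each `x` into an
average of nearby centres, and each centre is then sent to a point of `Y` by `f ∘ q`, where `q` is a
simple function `ε`-close to the identity. This Markov map acts on measures continuously, because
its weights are continuous and bounded.

Splitting moves a measure by at most `ε` in the `∞`-Wasserstein distance and costs `2Lε`; pushing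
along `f ∘ q`, which is Borel with finite image and has distortion at most `D + 2ε`, costs `L(D +
2ε)`. So the result is an `L(D + 4ε)`-map (`isDeltaMap_of_distortion_le`). The round trip is again a
finite Markov map, and by the codistortion bound it moves points by at most `D + 4ε`
(`dist_point_comp_le`). The straight line to the identity thus costs at most `2L(D + 4ε)`
(`deltaHomotopic_id_of_dist_le`). Finally `ε → 0`. -/

namespace PersistentThickening

open Topology BoundedContinuousFunction

/-! ### From homotopy equivalences to interleavings -/

section Interleaving

variable {A B : Type u} [TopologicalSpace A] [TopologicalSpace B] {φ : A → ℝ} {ψ : B → ℝ}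

/-- The map of sublevel sets induced by a `δ`-map. -/
def IsDeltaMap.sublevelMap {δ : ℝ} {Φ : C(A, B)} (h : IsDeltaMap φ ψ δ Φ) {r s : ℝ}
    (hrs : r + δ ≤ s) : (sublevelFiltration φ).obj r ⟶ (sublevelFiltration ψ).obj s :=
  TopCat.ofHom
    { toFun := fun a => ⟨Φ a.1, by linarith [h a.1, a.2]⟩
      continuous_toFun := by fun_prop }

/-- A `δ`-homotopy restricts to a homotopy of maps between sublevel sets. -/
def sublevelHomotopy {δ : ℝ} {Φ₀ Φ₁ : C(A, A)} (H : ContinuousMap.Homotopy Φ₀ Φ₁)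
    (hH : ∀ t : I, IsDeltaMap φ φ δ (H.curry t)) (h₀ : IsDeltaMap φ φ δ Φ₀)
    (h₁ : IsDeltaMap φ φ δ Φ₁) {r s : ℝ} (hrs : r + δ ≤ s) :
    TopCat.Homotopy (h₀.sublevelMap hrs) (h₁.sublevelMap hrs) where
  toFun p := ⟨H (p.1, p.2.1), by
    have h1 : φ (H (p.1, p.2.1)) ≤ φ p.2.1 + δ := hH p.1 p.2.1
    have h2 : φ p.2.1 < r := p.2.2
    linarith⟩
  continuous_toFun := by
    refine Continuous.subtype_mk (H.continuous.comp ?_) _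
    exact continuous_fst.prodMk (continuous_subtype_val.comp continuous_snd)
  map_zero_left a := Subtype.ext (H.apply_zero a.1)
  map_one_left a := Subtype.ext (H.apply_one a.1)

theorem homologyFunctor_map_eq_of_homotopy (F : Type v) [Field F] (k : ℕ) {S T : TopCat.{u}}
    {f g : S ⟶ T} (H : TopCat.Homotopy f g) :
    (homologyFunctor.{u, v} F k).map f = (homologyFunctor.{u, v} F k).map g :=
  H.congr_homologyMap_singularChainComplexFunctor (ModuleCat.of F (ULift.{u} F)) k

/-- A `δ`-homotopic pair of self-maps induces the same map on the homology of sublevel sets. -/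
theorem homologyFunctor_map_sublevelMap_eq (F : Type v) [Field F] (k : ℕ) {δ : ℝ}
    {Φ₀ Φ₁ : C(A, A)} (h : DeltaHomotopic φ φ δ Φ₀ Φ₁) (h₀ : IsDeltaMap φ φ δ Φ₀)
    (h₁ : IsDeltaMap φ φ δ Φ₁) {r s : ℝ} (hrs : r + δ ≤ s) :
    (homologyFunctor.{u, v} F k).map (h₀.sublevelMap hrs) =
      (homologyFunctor.{u, v} F k).map (h₁.sublevelMap hrs) := by
  obtain ⟨H, hH⟩ := h
  exact homologyFunctor_map_eq_of_homotopy F k (sublevelHomotopy H hH h₀ h₁ hrs)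

/-- The natural transformation of persistent homology modules induced by a `δ`-map. -/
noncomputable def IsDeltaMap.persistentHomologyMap (F : Type v) [Field F] (k : ℕ) {δ : ℝ}
    {Φ : C(A, B)} (h : IsDeltaMap φ ψ δ Φ) :
    persistentHomology.{u, v} F k φ ⟶ shift δ ⋙ persistentHomology.{u, v} F k ψ where
  app t := (homologyFunctor.{u, v} F k).map (h.sublevelMap (le_refl (t + δ)))
  naturality s t hst := by
    refine ((homologyFunctor.{u, v} F k).map_comp _ _).symm.trans
      (Eq.trans ?_ ((homologyFunctor.{u, v} F k).map_comp _ _))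
    rfl

/-- The composite is induced by `Ψ ∘ Φ` on sublevel sets; the `2δ`-homotopy replaces it by the
identity, whose sublevel map is the inclusion. Exchanging the roles of the two spaces gives the
other interleaving identity. -/
theorem sublevelMap_comp_eq (F : Type v) [Field F] (k : ℕ) {δ : ℝ≥0} {Φ : C(A, B)} {Ψ : C(B, A)}
    (hΦ : IsDeltaMap φ ψ δ Φ) (hΨ : IsDeltaMap ψ φ δ Ψ)
    (h : DeltaHomotopic φ φ (2 * δ) (Ψ.comp Φ) (ContinuousMap.id A)) (t : ℝ) :
    (hΦ.persistentHomologyMap F k).app t ≫ (hΨ.persistentHomologyMap F k).app (t + δ) =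
      (persistentHomology.{u, v} F k φ).map
        (homOfLE (show t ≤ t + δ + δ by linarith [δ.coe_nonneg])) := by
  have h₀ : IsDeltaMap φ φ (2 * δ) (Ψ.comp Φ) := fun a => by
    have h1 := hΦ a
    have h2 : φ (Ψ (Φ a)) ≤ ψ (Φ a) + δ := hΨ (Φ a)
    change φ (Ψ (Φ a)) ≤ _
    linarith
  have h₁ : IsDeltaMap φ φ (2 * δ) (ContinuousMap.id A) := fun a => by
    have := δ.coe_nonneg
    change φ a ≤ _
    linarith
  refine ((homologyFunctor.{u, v} F k).map_comp _ _).symm.trans ?_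
  exact homologyFunctor_map_sublevelMap_eq F k h h₀ h₁
    (r := t) (s := t + δ + δ) (by linarith)

theorem DeltaHomotopyEquivalent.interleaved (F : Type v) [Field F] (k : ℕ) {δ : ℝ≥0}
    (h : DeltaHomotopyEquivalent φ ψ δ) :
    Interleaved (persistentHomology.{u, v} F k φ) (persistentHomology.{u, v} F k ψ) δ := by
  obtain ⟨Φ, Ψ, hΦ, hΨ, h₁, h₂⟩ := h
  exact ⟨hΦ.persistentHomologyMap F k, hΨ.persistentHomologyMap F k,
    sublevelMap_comp_eq F k hΦ hΨ h₁, sublevelMap_comp_eq F k hΨ hΦ h₂⟩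

theorem interleavingDist_le_dHT (F : Type v) [Field F] (k : ℕ) (φ : A → ℝ) (ψ : B → ℝ) :
    interleavingDist (persistentHomology.{u, v} F k φ) (persistentHomology.{u, v} F k ψ) ≤
      dHT φ ψ :=
  le_iInf₂ fun δ h => iInf₂_le δ (h.interleaved F k)

end Interleaving

/-! ### Convex combinations of Radon measures -/

section ConvexCombination

variable {X : Type u} [MetricSpace X] [MeasurableSpace X] [BorelSpace X]

/-- The convex combination `(1 - t) α + t β`. -/
noncomputable def convexComb (t : I) (α β : RadonProb X) : RadonProb X :=
  ⟨⟨ENNReal.ofReal (1 - t) • (α.1 : Measure X) + ENNReal.ofReal t • (β.1 : Measure X), ⟨by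
      have h0 := t.2.1
      have h1 := t.2.2
      simp [← ENNReal.ofReal_add (sub_nonneg.2 h1) h0]⟩⟩, by
    have := α.2
    have := β.2
    change Measure.InnerRegular
      (ENNReal.ofReal (1 - t) • (α.1 : Measure X) + ENNReal.ofReal t • (β.1 : Measure X))
    infer_instance⟩

theorem coe_convexComb (t : I) (α β : RadonProb X) :
    ((convexComb t α β).1 : Measure X) =
      ENNReal.ofReal (1 - t) • (α.1 : Measure X) + ENNReal.ofReal t • (β.1 : Measure X) := rfl

theorem RadonProb.ext {α β : RadonProb X} (h : (α.1 : Measure X) = (β.1 : Measure X)) : α = β :=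
  Subtype.ext (Subtype.ext h)

@[simp]
theorem convexComb_zero (α β : RadonProb X) : convexComb 0 α β = α :=
  RadonProb.ext (by simp [coe_convexComb])

@[simp]
theorem convexComb_one (α β : RadonProb X) : convexComb 1 α β = β :=
  RadonProb.ext (by simp [coe_convexComb])

theorem RadonProb.continuous_lintegral (f : X →ᵇ ℝ≥0) :
    Continuous fun α : RadonProb X => ∫⁻ x, f x ∂(α.1 : Measure X) :=
  (ProbabilityMeasure.continuous_lintegral_boundedContinuousFunction f).comp continuous_subtype_val

theorem RadonProb.lintegral_ne_top (f : X →ᵇ ℝ≥0) (α : RadonProb X) :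
    ∫⁻ x, f x ∂(α.1 : Measure X) ≠ ⊤ :=
  (BoundedContinuousFunction.lintegral_lt_top_of_nnreal _ f).ne

theorem continuous_radonProb_iff {S : Type*} [TopologicalSpace S] {h : S → RadonProb X} :
    Continuous h ↔ ∀ f : X →ᵇ ℝ≥0, Continuous fun s => ∫⁻ x, f x ∂((h s).1 : Measure X) :=
  continuous_induced_rng.trans ProbabilityMeasure.continuous_iff_forall_continuous_lintegral

theorem continuous_convexComb :
    Continuous fun p : I × RadonProb X × RadonProb X => convexComb p.1 p.2.1 p.2.2 := by
  refine continuous_radonProb_iff.2 fun f => ?_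
  simp only [coe_convexComb, lintegral_add_measure, lintegral_smul_measure, smul_eq_mul]
  -- Multiplication on `ℝ≥0∞` is continuous away from `(0, ∞)` and `(∞, 0)`, so finiteness of both
  -- factors is used.
  have hmul {u : I → ℝ} (hu : Continuous u) {v : I × RadonProb X × RadonProb X → RadonProb X}
      (hv : Continuous v) : Continuous fun p : I × RadonProb X × RadonProb X =>
        ENNReal.ofReal (u p.1) * ∫⁻ x, f x ∂((v p).1 : Measure X) :=
    continuous_iff_continuousAt.2 fun p => ENNReal.Tendsto.mul
      (ENNReal.continuous_ofReal.comp (hu.comp continuous_fst)).continuousAt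
      (Or.inr (RadonProb.lintegral_ne_top f _))
      ((RadonProb.continuous_lintegral f).comp hv).continuousAt (Or.inr ENNReal.ofReal_ne_top)
  exact (hmul (u := fun t => 1 - t) (v := fun p => p.2.1) (by fun_prop) (by fun_prop)).add
    (hmul (u := fun t => t) (v := fun p => p.2.2) (by fun_prop) (by fun_prop))

theorem finite_support_convexComb {t : I} {α β : RadonProb X}
    (hα : (α.1 : Measure X).support.Finite) (hβ : (β.1 : Measure X).support.Finite) :
    ((convexComb t α β).1 : Measure X).support.Finite := by
  rw [coe_convexComb, Measure.support_add]
  exact (hα.subset Measure.smul_absolutelyContinuous.support_mono).union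
    (hβ.subset Measure.smul_absolutelyContinuous.support_mono)

end ConvexCombination

/-- A Markov map from `X` to finitely many points of `Y`, with continuous transition
probabilities. -/
structure FiniteMarkovMap (ι : Type*) [Fintype ι] (X Y : Type*) [TopologicalSpace X] where
  /-- The transition probabilities. -/
  weight : ι → C(X, ℝ≥0)
  sum_weight : ∀ x, ∑ i, weight i x = 1
  /-- The target points. -/
  point : ι → Y

/-! ### Finite Markov maps and their action on measures -/

namespace FiniteMarkovMap

variable {ι κ : Type*} [Fintype ι] [Fintype κ]

/-- Composition of finite Markov maps. -/
noncomputable def comp {X Y Z : Type*} [TopologicalSpace X] [TopologicalSpace Y]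
    (K' : FiniteMarkovMap κ Y Z) (K : FiniteMarkovMap ι X Y) : FiniteMarkovMap κ X Z where
  weight j := ∑ i, K'.weight j (K.point i) • K.weight i
  sum_weight x := by
    simp only [ContinuousMap.sum_apply, ContinuousMap.smul_apply, smul_eq_mul]
    rw [Finset.sum_comm]
    simp only [← Finset.sum_mul, K'.sum_weight, one_mul, K.sum_weight]
  point := K'.point

/-- Postcomposition with a map of points. -/
def map {X Y Z : Type*} [TopologicalSpace X] (f : Y → Z) (K : FiniteMarkovMap ι X Y) :
    FiniteMarkovMap ι X Z where
  weight := K.weight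
  sum_weight := K.sum_weight
  point := f ∘ K.point

theorem weight_le_one {X Y : Type*} [TopologicalSpace X] (K : FiniteMarkovMap ι X Y) (i : ι)
    (x : X) : K.weight i x ≤ 1 :=
  (Finset.single_le_sum (f := fun i => K.weight i x) (fun _ _ => zero_le)
    (Finset.mem_univ i)).trans_eq (K.sum_weight x)

/-- The transition probabilities as bounded functions. -/
noncomputable def boundedWeight {X Y : Type*} [TopologicalSpace X] (K : FiniteMarkovMap ι X Y)
    (i : ι) : X →ᵇ ℝ≥0 :=
  BoundedContinuousFunction.mkOfBound (K.weight i) 1 fun x y => by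
    have h1 := K.weight_le_one i x
    have h2 := K.weight_le_one i y
    rw [NNReal.dist_eq, abs_le]
    have h3 := (K.weight i x).2
    have h4 := (K.weight i y).2
    rw [← NNReal.coe_le_coe, NNReal.coe_one] at h1 h2
    constructor <;> linarith

theorem sum_lintegral_weight {X Y : Type*} [TopologicalSpace X] [MeasurableSpace X]
    [OpensMeasurableSpace X] (K : FiniteMarkovMap ι X Y) (α : Measure X) :
    ∑ i, ∫⁻ x, K.weight i x ∂α = α Set.univ := by
  rw [← lintegral_finsetSum _ fun i _ => by fun_prop]
  have (x : X) : ∑ i, (K.weight i x : ℝ≥0∞) = 1 := by exact_mod_cast K.sum_weight x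
  simp [this]

variable {X Y Z : Type u} [MetricSpace X] [MeasurableSpace X] [BorelSpace X]
  [MetricSpace Y] [MeasurableSpace Y] [BorelSpace Y] [MetricSpace Z] [MeasurableSpace Z]
  [BorelSpace Z]

theorem sum_withDensity_weight {X Y : Type*} [TopologicalSpace X] [MeasurableSpace X]
    [OpensMeasurableSpace X] (K : FiniteMarkovMap ι X Y) (α : Measure X) :
    ∑ i, α.withDensity (fun x => K.weight i x) = α := by
  have hK (x : X) : ∑ i, (K.weight i x : ℝ≥0∞) = 1 := by exact_mod_cast K.sum_weight x
  ext B hB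
  rw [Measure.finsetSum_apply]
  simp only [withDensity_apply _ hB]
  rw [← lintegral_finsetSum _ fun i _ => by fun_prop]
  simp [hK]

/-- The action of a finite Markov map on probability measures. -/
noncomputable def act (K : FiniteMarkovMap ι X Y) (α : RadonProb X) : RadonProb Y :=
  ⟨⟨∑ i, (∫⁻ x, K.weight i x ∂(α.1 : Measure X)) • Measure.dirac (K.point i), ⟨by
      simp [K.sum_lintegral_weight]⟩⟩, by
    change Measure.InnerRegular
      (∑ i, (∫⁻ x, K.weight i x ∂(α.1 : Measure X)) • Measure.dirac (K.point i))
    have (y : Y) : (Measure.dirac y).InnerRegular := by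
      have := innerRegular_map_of_finite_range (Measure.dirac y) (f := fun _ : Y => y)
        measurable_const (Set.finite_range_const)
      simpa using this
    infer_instance⟩

theorem coe_act (K : FiniteMarkovMap ι X Y) (α : RadonProb X) :
    ((K.act α).1 : Measure Y) =
      ∑ i, (∫⁻ x, K.weight i x ∂(α.1 : Measure X)) • Measure.dirac (K.point i) := rfl

theorem lintegral_act (K : FiniteMarkovMap ι X Y) (α : RadonProb X) (f : C(Y, ℝ≥0)) :
    ∫⁻ y, f y ∂((K.act α).1 : Measure Y) =
      ∑ i, (∫⁻ x, K.weight i x ∂(α.1 : Measure X)) * f (K.point i) := by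
  simp [coe_act]

theorem continuous_act (K : FiniteMarkovMap ι X Y) : Continuous K.act := by
  refine continuous_radonProb_iff.2 fun f => ?_
  have (α : RadonProb X) := K.lintegral_act α f.toContinuousMap
  simp only [BoundedContinuousFunction.coe_toContinuousMap] at this
  simp only [this]
  refine continuous_finsetSum _ fun i _ => ?_
  exact (ENNReal.continuous_mul_const ENNReal.coe_ne_top).comp
    (RadonProb.continuous_lintegral (K.boundedWeight i))

theorem finite_support_act (K : FiniteMarkovMap ι X Y) (α : RadonProb X) :
    ((K.act α).1 : Measure Y).support.Finite := by
  have hfin := Set.finite_range K.point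
  refine hfin.subset (Measure.support_subset_of_isClosed hfin.isClosed ?_)
  rw [mem_ae_iff, coe_act]
  simp [hfin.measurableSet.compl]

/-- This identifies the round trip `Ψ ∘ Φ` with the action of a single Markov map, to which the
straight-line estimate applies. -/
theorem act_comp (K' : FiniteMarkovMap κ Y Z) (K : FiniteMarkovMap ι X Y) (α : RadonProb X) :
    (K'.comp K).act α = K'.act (K.act α) := by
  refine RadonProb.ext ?_
  rw [coe_act, coe_act]
  refine Finset.sum_congr rfl fun j _ => ?_
  rw [lintegral_act]
  congr 1
  simp only [comp, ContinuousMap.sum_apply, ContinuousMap.smul_apply, smul_eq_mul,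
    ENNReal.ofNNReal_finsetSum, ENNReal.coe_mul]
  rw [lintegral_finsetSum _ fun i _ => by fun_prop]
  refine Finset.sum_congr rfl fun i _ => ?_
  rw [lintegral_const_mul _ (by fun_prop), mul_comm]

/-- Only the target points change, not the weights. This is how the push-forward axiom reaches the
continuous map built from `f ∘ q`. -/
theorem push_act (K : FiniteMarkovMap ι X Y) (f : Y → Z) (hf : Measurable f)
    (hfin : (Set.range f).Finite) (α : RadonProb X) :
    (K.act α).push f hf hfin = (K.map f).act α := by
  refine RadonProb.ext ?_
  change Measure.map f ((K.act α).1 : Measure Y) = _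
  rw [coe_act, coe_act, ← Measure.mapₗ_apply_of_measurable hf, map_sum]
  simp [Measure.mapₗ_apply_of_measurable hf, Measure.map_dirac' hf, map]

/-- If a finite Markov map moves points by at most `C`, then the straight line between the image
of `α` and `α` stays within `∞`-Wasserstein distance `C` of `α`. -/
theorem wassersteinInfty_convexComb_act_le [SecondCountableTopology X]
    (K : FiniteMarkovMap ι X X) {C : ℝ} (hC : 0 ≤ C)
    (h : ∀ x i, K.weight i x ≠ 0 → dist (K.point i) x ≤ C) (t : I) (α : RadonProb X) :
    wassersteinInfty (convexComb t (K.act α) α) α ≤ ENNReal.ofReal C := by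
  set a : Measure X := (α.1 : Measure X) with ha
  set s : Set (X × X) := {p | dist p.1 p.2 ≤ C} with hs
  have hsc : IsClosed s := isClosed_le continuous_dist continuous_const
  have hpm (i : ι) : Measurable fun x : X => (K.point i, x) := by fun_prop
  have hdm : Measurable fun x : X => (x, x) := by fun_prop
  have hw (i : ι) : Measurable fun x : X => (K.weight i x : ℝ≥0∞) := by fun_prop
  set m : ι → Measure (X × X) := fun i =>
    (a.withDensity fun x => K.weight i x).map fun x => (K.point i, x) with hm
  have hmap (q : X × X → X) (hq : Measurable q) :
      (ENNReal.ofReal (1 - t) • (∑ i, m i) + ENNReal.ofReal t • a.map fun x => (x, x)).map q =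
        ENNReal.ofReal (1 - t) • (∑ i, (m i).map q) +
          ENNReal.ofReal t • (a.map fun x => (x, x)).map q := by
    rw [← Measure.mapₗ_apply_of_measurable hq, map_add, map_smul, map_smul, map_sum]
    simp only [Measure.mapₗ_apply_of_measurable hq]
  -- The coupling sends the share `K.weight i` of the mass at `x` to `(K.point i, x)` with total
  -- weight `1 - t`, and leaves the rest on the diagonal.
  refine iInf₂_le_of_le (ENNReal.ofReal (1 - t) • (∑ i, m i) + ENNReal.ofReal t •
    a.map fun x => (x, x)) ⟨?_, ?_⟩ ?_
  · rw [hmap _ measurable_fst, Measure.map_map measurable_fst hdm]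
    simp only [hm, Measure.map_map measurable_fst (hpm _), Function.comp_def, Measure.map_const,
      Measure.map_id', coe_convexComb, coe_act, withDensity_apply _ MeasurableSet.univ,
      Measure.restrict_univ, ha]
  · rw [hmap _ measurable_snd, Measure.map_map measurable_snd hdm]
    simp only [hm, Measure.map_map measurable_snd (hpm _), Function.comp_def, Measure.map_id']
    rw [K.sum_withDensity_weight, ← add_smul, ← ENNReal.ofReal_add (sub_nonneg.2 t.2.2) t.2.1]
    simp [ha]
  · refine iSup₂_le fun p hp => ?_
    -- The closed set `s` has full measure, hence contains the support.
    have : p ∈ s := by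
      refine Measure.support_subset_of_isClosed hsc ?_ hp
      have hsm : MeasurableSet sᶜ := hsc.measurableSet.compl
      have hdiag : (fun x : X => (x, x)) ⁻¹' sᶜ = ∅ := by
        ext x
        simp [hs, hC]
      have hm0 (i : ι) : m i sᶜ = 0 := by
        rw [hm, Measure.map_apply (hpm i) hsm, withDensity_apply _ (hpm i hsm)]
        refine (setLIntegral_eq_zero_iff (hpm i hsm) (hw i)).2 (Filter.Eventually.of_forall ?_)
        intro x hx
        by_contra hne
        exact hx (h x i fun h0 => hne (by simp [h0]))
      rw [mem_ae_iff]
      simp [hm0, Measure.map_apply hdm hsm, hdiag]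
    rw [edist_dist]
    exact ENNReal.ofReal_le_ofReal this

end FiniteMarkovMap

/-! ### Approximating the identity of a totally bounded space -/

section Approximation

variable (X : Type u) [MetricSpace X] [TotallyBoundedSpace X]

theorem exists_finset_dist_lt {ε : ℝ} (hε : 0 < ε) :
    ∃ s : Finset X, ∀ x, ∃ y ∈ s, dist x y < ε := by
  obtain ⟨t, ht, hcov⟩ := Metric.totallyBounded_iff.1
    (TotallyBoundedSpace.totallyBounded_univ (X := X)) ε hε
  refine ⟨ht.toFinset, fun x => ?_⟩
  obtain ⟨y, hy, hxy⟩ := Set.mem_iUnion₂.1 (hcov (Set.mem_univ x))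
  exact ⟨y, ht.mem_toFinset.2 hy, hxy⟩

/-- Needed so that closed subsets of `X × X` are measurable for the product σ-algebra on which
couplings live. -/
instance : SecondCountableTopology X := by
  have : TopologicalSpace.SeparableSpace X := TopologicalSpace.isSeparable_univ_iff.1
    (TotallyBoundedSpace.totallyBounded_univ (X := X)).isSeparable
  exact UniformSpace.secondCountable_of_separable X

/-- On a totally bounded space the identity is uniformly approximated by finite Markov maps. -/
theorem exists_finiteMarkovMap_dist_lt {ε : ℝ} (hε : 0 < ε) :
    ∃ (s : Finset X) (K : FiniteMarkovMap s X X), ∀ x i, K.weight i x ≠ 0 →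
      dist (K.point i) x < ε := by
  obtain ⟨s, hs⟩ := exists_finset_dist_lt X hε
  -- Tent functions supported near the points of the net; normalised, they form the partition of
  -- unity.
  let b (i : s) (x : X) : ℝ≥0 := Real.toNNReal (ε - dist (i : X) x)
  have hb (i : s) : Continuous (b i) := by fun_prop
  have hpos (x : X) : ∑ i, b i x ≠ 0 := by
    obtain ⟨y, hy, hxy⟩ := hs x
    rw [dist_comm] at hxy
    intro h0
    have := Finset.sum_eq_zero_iff.1 h0 ⟨y, hy⟩ (Finset.mem_univ _)
    simp only [b, Real.toNNReal_eq_zero] at this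
    linarith
  refine ⟨s, ⟨fun i => ⟨fun x => b i x / ∑ j, b j x, ?_⟩, fun x => ?_, fun i => i⟩, ?_⟩
  · exact (hb i).div (continuous_finsetSum _ fun j _ => hb j) hpos
  · simp only [ContinuousMap.coe_mk]
    rw [← Finset.sum_div, div_self (hpos x)]
  · intro x i hi
    have h1 : b i x ≠ 0 := fun h0 => hi (by simp [h0])
    have h2 : ¬ ε - dist (i : X) x ≤ 0 := fun h => h1 (Real.toNNReal_eq_zero.2 h)
    change dist (i : X) x < ε
    linarith

/-- On a totally bounded space the identity is uniformly approximated by simple functions. -/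
theorem exists_simpleFunc_dist_lt [MeasurableSpace X] [BorelSpace X] {ε : ℝ} (hε : 0 < ε) :
    ∃ q : SimpleFunc X X, ∀ x, dist (q x) x < ε := by
  rcases isEmpty_or_nonempty X with hX | ⟨⟨x₀⟩⟩
  · exact ⟨SimpleFunc.ofIsEmpty, fun x => isEmptyElim x⟩
  · obtain ⟨s, hs⟩ := exists_finset_dist_lt X hε
    -- Induction on the net, claiming closeness only on the part of `X` that the net covers.
    have key (s : Finset X) : ∃ q : SimpleFunc X X, ∀ x, (∃ y ∈ s, dist x y < ε) →
        dist (q x) x < ε := by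
      classical
      induction s using Finset.induction with
      | empty => exact ⟨SimpleFunc.const X x₀, by simp⟩
      | insert a s _ ih =>
        obtain ⟨q, hq⟩ := ih
        refine ⟨SimpleFunc.piecewise (Metric.ball a ε) Metric.isOpen_ball.measurableSet
          (SimpleFunc.const X a) q, fun x hx => ?_⟩
        rw [SimpleFunc.piecewise_apply]
        split_ifs with h
        · simpa [dist_comm] using h
        · obtain ⟨y, hy, hxy⟩ := hx
          rcases Finset.mem_insert.1 hy with rfl | hy
          · exact absurd hxy h
          · exact hq x ⟨y, hy, hxy⟩
    obtain ⟨q, hq⟩ := key s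
    exact ⟨q, fun x => hq x (hs x)⟩

end Approximation

/-! ### Estimates for distortion and codistortion -/

section Distortion

variable {X Y : Type u} [MetricSpace X] [MetricSpace Y]

theorem abs_dist_sub_le_of_distortion_le {f : X → Y} {D : ℝ} (hD : 0 ≤ D)
    (h : distortion f ≤ ENNReal.ofReal D) (x x' : X) :
    |dist x x' - dist (f x) (f x')| ≤ D :=
  (ENNReal.ofReal_le_ofReal_iff hD).1
    ((le_iSup₂ (f := fun x x' => ENNReal.ofReal |dist x x' - dist (f x) (f x')|) x x').trans h)

theorem abs_dist_sub_le_of_codistortion_le {f : X → Y} {g : Y → X} {D : ℝ} (hD : 0 ≤ D)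
    (h : codistortion f g ≤ ENNReal.ofReal D) (x : X) (y : Y) :
    |dist x (g y) - dist (f x) y| ≤ D :=
  (ENNReal.ofReal_le_ofReal_iff hD).1
    ((le_iSup₂ (f := fun x y => ENNReal.ofReal |dist x (g y) - dist (f x) y|) x y).trans h)

theorem codistortion_comm (f : X → Y) (g : Y → X) : codistortion f g = codistortion g f := by
  unfold codistortion
  rw [iSup_comm]
  refine iSup_congr fun y => iSup_congr fun x => ?_
  rw [abs_sub_comm, dist_comm (f x), dist_comm x]

theorem distortion_comp_le {f : X → Y} {D : ℝ} (hD : 0 ≤ D) (h : distortion f ≤ ENNReal.ofReal D)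
    {q : X → X} {ε : ℝ} (hq : ∀ x, dist (q x) x < ε) :
    distortion (f ∘ q) ≤ ENNReal.ofReal (D + 2 * ε) := by
  refine iSup₂_le fun x x' => ENNReal.ofReal_le_ofReal ?_
  have h1 := abs_le.1 (abs_dist_sub_le_of_distortion_le hD h (q x) (q x'))
  have h2 := hq x
  have h3 := hq x'
  have h4 := dist_triangle4 x (q x) (q x') x'
  have h5 := dist_triangle4 (q x) x x' (q x')
  rw [dist_comm x (q x)] at h4
  rw [dist_comm x' (q x')] at h5
  rw [abs_le]
  simp only [Function.comp]
  constructor <;> linarith [h1.1, h1.2]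

end Distortion

/-- A family of Radon probability measures, given by an embedding, that is closed under convex
combinations and contains all finitely supported measures. -/
structure IsConvexFamily {A : Type*} [TopologicalSpace A] {X : Type u} [MetricSpace X]
    [MeasurableSpace X] [BorelSpace X] (e : A → RadonProb X) : Prop where
  isEmbedding : IsEmbedding e
  finite_mem : ∀ α : RadonProb X, (α.1 : Measure X).support.Finite → α ∈ Set.range e
  convexComb_mem : ∀ (t : I) (a b : A), convexComb t (e a) (e b) ∈ Set.range e

theorem isConvexFamily_id (X : Type u) [MetricSpace X] [MeasurableSpace X] [BorelSpace X] :
    IsConvexFamily (id : RadonProb X → RadonProb X) :=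
  ⟨.id, fun α _ => ⟨α, rfl⟩, fun _ _ _ => ⟨_, rfl⟩⟩

theorem isConvexFamily_val (X : Type u) [MetricSpace X] [MeasurableSpace X] [BorelSpace X] :
    IsConvexFamily (Subtype.val : FinProb X → RadonProb X) :=
  ⟨.subtypeVal, fun α h => ⟨⟨α, h⟩, rfl⟩, fun _ a b =>
    ⟨⟨_, finite_support_convexComb a.2 b.2⟩, rfl⟩⟩

/-! ### Stability for convex families, covering Radon and finitely supported measures at once -/

section Stability

variable {X Y : Type u} [MetricSpace X] [MeasurableSpace X] [BorelSpace X]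
  [MetricSpace Y] [MeasurableSpace Y] [BorelSpace Y] {A B : Type u} [TopologicalSpace A] [TopologicalSpace B] {eA : A → RadonProb X}
  {eB : B → RadonProb Y} {φ : A → ℝ} {ψ : B → ℝ} {L : ℝ}

/-- `φ` is Lipschitz for the `∞`-Wasserstein distance. -/
def IsWassersteinLipschitz (L : ℝ) (eA : A → RadonProb X) (φ : A → ℝ) : Prop :=
  ∀ a a', |φ a - φ a'| ≤ 2 * L * (wassersteinInfty (eA a) (eA a')).toReal

/-- Pushing forward along a Borel map with finite image increases the invariant by at most `L`
times the distortion of the map. -/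
def PushControlled (L : ℝ) (eA : A → RadonProb X) (eB : B → RadonProb Y) (φ : A → ℝ)
    (ψ : B → ℝ) : Prop :=
  ∀ (f : X → Y) (hf : Measurable f) (hfin : (Set.range f).Finite) (a : A) (b : B),
    eB b = (eA a).push f hf hfin → ψ b ≤ φ a + L * (distortion f).toReal

/-- The map of convex families induced by a finite Markov map. -/
theorem IsConvexFamily.exists_lift {ι : Type*} [Fintype ι] (hA : IsConvexFamily eA)
    (hB : IsConvexFamily eB) (K : FiniteMarkovMap ι X Y) :
    ∃ Φ : C(A, B), ∀ a, eB (Φ a) = K.act (eA a) := by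
  choose Φ hΦ using fun a => hB.finite_mem _ (K.finite_support_act (eA a))
  refine ⟨⟨Φ, hB.isEmbedding.isInducing.continuous_iff.2 ?_⟩, hΦ⟩
  rw [show eB ∘ Φ = K.act ∘ eA from funext hΦ]
  exact K.continuous_act.comp hA.isEmbedding.continuous

/-- A lift of a finite Markov map moving points by at most `C` is homotopic to the identity. -/
theorem deltaHomotopic_id_of_dist_le [SecondCountableTopology X] {ι : Type*} [Fintype ι] (hA : IsConvexFamily eA)
    (hL : 0 ≤ L) (hφ : IsWassersteinLipschitz L eA φ) (K : FiniteMarkovMap ι X X) {C : ℝ} (hC : 0 ≤ C)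
    (h : ∀ x i, K.weight i x ≠ 0 → dist (K.point i) x ≤ C) {Φ : C(A, A)}
    (hΦ : ∀ a, eA (Φ a) = K.act (eA a)) :
    DeltaHomotopic φ φ (2 * (L * C)) Φ (ContinuousMap.id A) := by
  choose T hT using fun p : I × A => hA.convexComb_mem p.1 (Φ p.2) p.2
  have hTc : Continuous T := by
    refine hA.isEmbedding.isInducing.continuous_iff.2 ?_
    rw [show eA ∘ T = fun p => convexComb p.1 (eA (Φ p.2)) (eA p.2) from funext hT]
    have := hA.isEmbedding.continuous
    exact continuous_convexComb.comp (f := fun p : I × A => (p.1, eA (Φ p.2), eA p.2))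
      (by fun_prop)
  refine ⟨⟨⟨T, hTc⟩, fun a => hA.isEmbedding.injective ?_, fun a => hA.isEmbedding.injective ?_⟩,
    fun t a => ?_⟩
  · exact (hT _).trans (convexComb_zero _ _)
  · exact (hT _).trans (convexComb_one _ _)
  · change φ (T (t, a)) ≤ φ a + 2 * (L * C)
    have h1 := (abs_le.1 (hφ (T (t, a)) a)).2
    have h2 : wassersteinInfty (eA (T (t, a))) (eA a) ≤ ENNReal.ofReal C := by
      rw [hT, hΦ]
      exact K.wassersteinInfty_convexComb_act_le hC h t (eA a)
    have h3 := mul_le_mul_of_nonneg_left (ENNReal.toReal_le_of_le_ofReal hC h2)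
      (show 0 ≤ 2 * L by positivity)
    linarith

/-- A lift of `f ∘ q` composed with a finite Markov map close to the identity is a `δ`-map. -/
theorem isDeltaMap_of_distortion_le [SecondCountableTopology X] {ι : Type*} [Fintype ι]
    (hA : IsConvexFamily eA) (hL : 0 ≤ L) (hφ : IsWassersteinLipschitz L eA φ) (hpush : PushControlled L eA eB φ ψ)
    (K : FiniteMarkovMap ι X X) {ε : ℝ} (hε : 0 ≤ ε)
    (hK : ∀ x i, K.weight i x ≠ 0 → dist (K.point i) x < ε)
    (q : SimpleFunc X X) (hq : ∀ x, dist (q x) x < ε) {f : X → Y} {D : ℝ} (hD : 0 ≤ D)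
    (hf : distortion f ≤ ENNReal.ofReal D) {Φ : C(A, B)}
    (hΦ : ∀ a, eB (Φ a) = (K.map (f ∘ q)).act (eA a)) :
    IsDeltaMap φ ψ (L * (D + 4 * ε)) Φ := by
  intro a
  obtain ⟨a', ha'⟩ := hA.finite_mem _ (K.finite_support_act (eA a))
  have hm : Measurable (f ∘ q) := (q.map f).measurable
  have hfin : (Set.range (f ∘ q)).Finite := (q.map f).finite_range
  have h1 := hpush (f ∘ q) hm hfin a' (Φ a)
    (by rw [hΦ, ha', K.push_act])
  have h2 := mul_le_mul_of_nonneg_left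
    (ENNReal.toReal_le_of_le_ofReal (by positivity) (distortion_comp_le hD hf hq)) hL
  have h3 := (abs_le.1 (hφ a' a)).2
  have h4 : wassersteinInfty (eA a') (eA a) ≤ ENNReal.ofReal ε := by
    -- The start `t = 0` of the straight line is `K.act (eA a)` itself.
    rw [ha', ← convexComb_zero (K.act (eA a)) (eA a)]
    exact K.wassersteinInfty_convexComb_act_le hε (fun x i h => (hK x i h).le) 0 (eA a)
  have h5 := mul_le_mul_of_nonneg_left (ENNReal.toReal_le_of_le_ofReal hε h4)
    (show 0 ≤ 2 * L by positivity)
  linarith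

/-- A positive transition probability forces a chain through some intermediate centre. Each of `K`,
`q`, `K'`, `q'` contributes one `ε`, and the codistortion contributes `D`. -/
theorem dist_point_comp_le {X Y : Type u} [MetricSpace X] [MetricSpace Y] {ι κ : Type*}
    [Fintype ι] [Fintype κ] {ε : ℝ}
    {K : FiniteMarkovMap ι X X} (hK : ∀ x i, K.weight i x ≠ 0 → dist (K.point i) x < ε)
    {K' : FiniteMarkovMap κ Y Y} (hK' : ∀ y j, K'.weight j y ≠ 0 → dist (K'.point j) y < ε)
    {q : X → X} (hq : ∀ x, dist (q x) x < ε) {q' : Y → Y} (hq' : ∀ y, dist (q' y) y < ε)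
    {f : X → Y} {g : Y → X} {D : ℝ} (hD : 0 ≤ D) (hfg : codistortion f g ≤ ENNReal.ofReal D)
    (x : X) (j : κ) (h : ((K'.map (g ∘ q')).comp (K.map (f ∘ q))).weight j x ≠ 0) :
    dist (((K'.map (g ∘ q')).comp (K.map (f ∘ q))).point j) x ≤ D + 4 * ε := by
  obtain ⟨i, h1, h2⟩ : ∃ i, K'.weight j (f (q (K.point i))) ≠ 0 ∧ K.weight i x ≠ 0 := by
    by_contra! hne
    refine h ?_
    simp only [FiniteMarkovMap.comp, FiniteMarkovMap.map, ContinuousMap.sum_apply,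
      ContinuousMap.smul_apply, smul_eq_mul]
    refine Finset.sum_eq_zero fun i _ => ?_
    by_cases hi : K'.weight j (f (q (K.point i))) = 0
    · exact mul_eq_zero_of_left hi _
    · exact mul_eq_zero_of_right _ (hne i hi)
  change dist (g (q' (K'.point j))) x ≤ D + 4 * ε
  have h3 := (abs_le.1 (abs_dist_sub_le_of_codistortion_le hD hfg (q (K.point i))
    (q' (K'.point j)))).2
  have h4 := dist_triangle4 (g (q' (K'.point j))) (q (K.point i)) (K.point i) x
  have h5 := dist_triangle (f (q (K.point i))) (K'.point j) (q' (K'.point j))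
  rw [dist_comm (q (K.point i))] at h3
  have h6 := hK' _ _ h1
  rw [dist_comm] at h6
  have h7 := hq' (K'.point j)
  rw [dist_comm] at h7
  linarith [hq (K.point i), hK _ _ h2]

/-- One constant serves twice: `D + 4ε` bounds both the loss of the maps divided by `L` and the
displacement of the round trips, so the homotopies get exactly `2δ`. -/
theorem deltaHomotopyEquivalent_of_distortion_le [TotallyBoundedSpace X] [TotallyBoundedSpace Y]
    (hA : IsConvexFamily eA) (hB : IsConvexFamily eB) (hL : 0 ≤ L) (hφ : IsWassersteinLipschitz L eA φ)
    (hψ : IsWassersteinLipschitz L eB ψ) (hAB : PushControlled L eA eB φ ψ)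
    (hBA : PushControlled L eB eA ψ φ) {f : X → Y} {g : Y → X} {D : ℝ} (hD : 0 ≤ D)
    (hf : distortion f ≤ ENNReal.ofReal D) (hg : distortion g ≤ ENNReal.ofReal D)
    (hfg : codistortion f g ≤ ENNReal.ofReal D) {ε : ℝ} (hε : 0 < ε) :
    DeltaHomotopyEquivalent φ ψ (L * (D + 4 * ε)) := by
  obtain ⟨s, K, hK⟩ := exists_finiteMarkovMap_dist_lt X hε
  obtain ⟨s', K', hK'⟩ := exists_finiteMarkovMap_dist_lt Y hε
  obtain ⟨q, hq⟩ := exists_simpleFunc_dist_lt X hε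
  obtain ⟨q', hq'⟩ := exists_simpleFunc_dist_lt Y hε
  obtain ⟨Φ, hΦ⟩ := hA.exists_lift hB (K.map (f ∘ q))
  obtain ⟨Ψ, hΨ⟩ := hB.exists_lift hA (K'.map (g ∘ q'))
  refine ⟨Φ, Ψ, isDeltaMap_of_distortion_le hA hL hφ hAB K hε.le hK q hq hD hf hΦ,
    isDeltaMap_of_distortion_le hB hL hψ hBA K' hε.le hK' q' hq' hD hg hΨ, ?_, ?_⟩
  · refine deltaHomotopic_id_of_dist_le hA hL hφ ((K'.map (g ∘ q')).comp (K.map (f ∘ q)))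
      (by positivity) (dist_point_comp_le hK hK' hq hq' hD hfg) fun a => ?_
    rw [FiniteMarkovMap.act_comp, ← hΦ, ← hΨ]
    rfl
  · refine deltaHomotopic_id_of_dist_le hB hL hψ ((K.map (f ∘ q)).comp (K'.map (g ∘ q')))
      (by positivity)
      (dist_point_comp_le hK' hK hq' hq hD (codistortion_comm f g ▸ hfg)) fun b => ?_
    rw [FiniteMarkovMap.act_comp, ← hΨ, ← hΦ]
    rfl

theorem dHT_le_ghDistance [TotallyBoundedSpace X] [TotallyBoundedSpace Y]
    (hA : IsConvexFamily eA) (hB : IsConvexFamily eB) (hL : 0 < L) (hφ : IsWassersteinLipschitz L eA φ)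
    (hψ : IsWassersteinLipschitz L eB ψ) (hAB : PushControlled L eA eB φ ψ)
    (hBA : PushControlled L eB eA ψ φ) :
    dHT φ ψ ≤ 2 * ENNReal.ofReal L * ghDistance X Y := by
  have hL0 : ENNReal.ofReal L ≠ 0 := by simpa using hL
  -- The factor `1 / 2` in `ghDistance` leaves `L` times an infimum, to be tested on each pair `f`,
  -- `g`.
  have h2 : 2 * ENNReal.ofReal L * (1 / 2) = ENNReal.ofReal L := by
    rw [mul_comm 2, mul_assoc, ENNReal.mul_div_cancel (by simp) (by simp), mul_one]
  rw [ghDistance, ← mul_assoc, h2, ENNReal.mul_iInf_of_ne hL0 ENNReal.ofReal_ne_top]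
  refine le_iInf fun f => ?_
  rw [ENNReal.mul_iInf_of_ne hL0 ENNReal.ofReal_ne_top]
  refine le_iInf fun g => ?_
  set M := max (max (distortion f) (distortion g)) (codistortion f g)
  by_cases htop : M = ⊤
  · rw [htop, ENNReal.mul_top hL0]
    exact le_top
  have hMD : M = ENNReal.ofReal M.toReal := (ENNReal.ofReal_toReal htop).symm
  refine ENNReal.le_of_forall_pos_le_add fun η hη _ => ?_
  have hη' : (0 : ℝ) < η := hη
  have hequiv := deltaHomotopyEquivalent_of_distortion_le hA hB hL.le hφ hψ hAB hBA
    (f := f) (g := g) (D := M.toReal) ENNReal.toReal_nonneg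
    (hMD ▸ (le_max_left _ _).trans (le_max_left _ _))
    (hMD ▸ (le_max_right _ _).trans (le_max_left _ _)) (hMD ▸ le_max_right _ _)
    -- Chosen so that the error `4Lε` equals `η`.
    (ε := η / (4 * L)) (by positivity)
  have hδ : L * (M.toReal + 4 * (η / (4 * L))) = L * M.toReal + η := by
    field_simp
  rw [hδ] at hequiv
  refine (iInf₂_le (NNReal.mk (L * M.toReal + η) (by positivity)) hequiv).trans_eq ?_
  rw [← ENNReal.ofReal_eq_coe_nnreal, ENNReal.ofReal_add (by positivity) hη'.le,
    ENNReal.ofReal_mul hL.le, ← hMD, ENNReal.ofReal_coe_nnreal]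

end Stability

theorem IsControlled.restrict {L : ℝ} {i : Invariant.{u}} (hi : IsControlled L i) :
    IsFinControlled L i.restrict where
  pos := hi.pos
  push_le X Y _ _ _ _ _ _ _ _ f hf hfin α := hi.push_le X Y f hf hfin α.1
  lipschitz X _ _ _ _ α β := hi.lipschitz X α.1 β.1

theorem IsControlled.dHT_le {L : ℝ} {i : Invariant.{u}} (hi : IsControlled L i) (X Y : Type u)
    [MetricSpace X] [TotallyBoundedSpace X] [MeasurableSpace X] [BorelSpace X]
    [MetricSpace Y] [TotallyBoundedSpace Y] [MeasurableSpace Y] [BorelSpace Y] :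
    dHT (i X) (i Y) ≤ 2 * ENNReal.ofReal L * ghDistance X Y :=
  dHT_le_ghDistance (isConvexFamily_id X) (isConvexFamily_id Y) hi.pos (hi.lipschitz X)
    (hi.lipschitz Y)
    (fun f hf hfin a b (hb : b = a.push f hf hfin) => by
      rw [hb]
      exact hi.push_le X Y f hf hfin a)
    (fun f hf hfin a b (hb : b = a.push f hf hfin) => by
      rw [hb]
      exact hi.push_le Y X f hf hfin a)

theorem IsFinControlled.dHT_le {L : ℝ} {j : FinInvariant.{u}} (hj : IsFinControlled L j)
    (X Y : Type u)
    [MetricSpace X] [TotallyBoundedSpace X] [MeasurableSpace X] [BorelSpace X]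
    [MetricSpace Y] [TotallyBoundedSpace Y] [MeasurableSpace Y] [BorelSpace Y] :
    dHT (j X) (j Y) ≤ 2 * ENNReal.ofReal L * ghDistance X Y :=
  dHT_le_ghDistance (isConvexFamily_val X) (isConvexFamily_val Y) hj.pos (hj.lipschitz X)
    (hj.lipschitz Y)
    (fun f hf hfin a b hb => by
      rw [show b = a.push f hf hfin from Subtype.ext hb]
      exact hj.push_le X Y f hf hfin a)
    (fun f hf hfin a b hb => by
      rw [show b = a.push f hf hfin from Subtype.ext hb]
      exact hj.push_le Y X f hf hfin a)

end PersistentThickening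

theorem theorem5p2 (F : Type v) [Field F] (k : ℕ) (L : ℝ)
    (X Y : Type u)
    [MetricSpace X] [TotallyBoundedSpace X] [MeasurableSpace X] [BorelSpace X]
    [MetricSpace Y] [TotallyBoundedSpace Y] [MeasurableSpace Y] [BorelSpace Y] :
    (∀ i : Invariant.{u}, IsControlled L i →
      (interleavingDist (persistentHomology F k (i X)) (persistentHomology F k (i Y))
          ≤ dHT (i X) (i Y) ∧
        dHT (i X) (i Y) ≤ 2 * ENNReal.ofReal L * ghDistance X Y) ∧
      (interleavingDist (persistentHomology F k (i.restrict X))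
            (persistentHomology F k (i.restrict Y))
          ≤ dHT (i.restrict X) (i.restrict Y) ∧
        dHT (i.restrict X) (i.restrict Y) ≤ 2 * ENNReal.ofReal L * ghDistance X Y)) ∧
    (∀ j : FinInvariant.{u}, IsFinControlled L j →
      interleavingDist (persistentHomology F k (j X)) (persistentHomology F k (j Y))
          ≤ dHT (j X) (j Y) ∧
        dHT (j X) (j Y) ≤ 2 * ENNReal.ofReal L * ghDistance X Y) := by
  exact ⟨fun i hi => ⟨⟨interleavingDist_le_dHT F k _ _, hi.dHT_le X Y⟩,
    interleavingDist_le_dHT F k _ _, hi.restrict.dHT_le X Y⟩,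
    fun j hj => ⟨interleavingDist_le_dHT F k _ _, hj.dHT_le X Y⟩⟩
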